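/- Let $T$ be a rooted tree with vertex set $[n]=\{1,\dots,n\}$ and edges oriented towards the root, and let $s\in[n]^n$. Drivers $1,\dots,n$ arrive in this order; driver $i$ goes to her preferred vertex $s_i$ and, if it is occupied, travels along the unique path towards the root and parks at the first unoccupied vertex she meets (leaving the tree without parking if there is none). She crosses each edge that she traverses in this search. The sequence $s$ is a parking function on $T$ if all $n$ drivers park. For a vertex $v$ let $T_v$ be the set of vertices $u$ having a directed path (possibly of length $0$) to $v$. A parking function $s$ on $T$ is prime if $|T_v|<|\{i : s_i\in T_v\}|$ for every non-root vertex $v$. An ordered tree is a rooted tree in which the children of every vertex are linearly ordered from left to right. Let $\mathcal{SRP}_n$ be the set of standardized restricted prime parking functions on $n$ vertices, that is, of pairs $(\mathcal T,p)$, where $\mathcal T$ is an ordered tree with vertex set $[n]$ and $p\in[n]^n$, such that 1. $p$ is a prime parking function on the rooted tree underlying $\mathcal T$; 2. for any two distinct siblings $u,v$ with parent $w$, the vertex $v$ is to the right of $u$ if and only if, when the drivers park according to $p$, the edge $(v,w)$ is crossed by some driver before the edge $(u,w)$ is crossed by any driver; 3. the vertices of $\mathcal T$ are labeled $1,\dots,n$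 in post-order (the subtrees of the children from left to right, then the vertex itself, recursively). Then for every $n\ge 1$, $$|\mathcal{SRP}_n| = C_{n-1}\,(n-1)!,$$ where $C_m=\frac1{m+1}\binom{2m}{m}$ is the $m$-th Catalan number. -/

import Mathlib

open scoped Nat

namespace TreeParking

/-- A rooted tree with vertex set `Fin n` (standing for `[n] = {1, …, n}`, in the same order), with
edges oriented towards the root: `parent u = some w` says that `u → w` is an edge. The root has no
parent, and from every vertex there is a directed path to the root; hence the root is the only
vertex without a parent and there are no directed cycles. -/
structure LabeledTree (n : ℕ) where
  parent : Fin n → Option (Fin n)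
  root : Fin n
  parent_root : parent root = none
  reaches_root : ∀ v, Relation.ReflTransGen (fun u w => parent u = some w) v root

namespace LabeledTree

variable {n : ℕ}

/-- `(u, w)` is an edge of `T`, i.e. `w` is the parent of `u`. -/
def Edge (T : LabeledTree n) (u w : Fin n) : Prop := T.parent u = some w

/-- `u ⪯ v` : there is a directed path (possibly of length zero) from `u` to `v`. -/
def Below (T : LabeledTree n) (u v : Fin n) : Prop := Relation.ReflTransGen T.Edge u v

/-- The vertex set of the subtree `T_v`, consisting of all `u ⪯ v`. -/
def subtree (T : LabeledTree n) (v : Fin n) : Set (Fin n) := {u | T.Below u v}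

/-- Two distinct vertices with the same parent. -/
def Siblings (T : LabeledTree n) (u v : Fin n) : Prop :=
  u ≠ v ∧ ∃ w, T.Edge u w ∧ T.Edge v w

/-- When `O` is the set of occupied spots, a driver preferring `v` parks at `w`: it is the first
unoccupied vertex on the directed path from `v` to the root. -/
def ParksAt (T : LabeledTree n) (O : Set (Fin n)) (v w : Fin n) : Prop :=
  T.Below v w ∧ w ∉ O ∧ ∀ x, T.Below v x → T.Below x w → x ≠ w → x ∈ O

/-- The set of occupied spots after the first `k` drivers have tried to park, the drivers
arriving in the order `0, 1, 2, …` and driver `i` preferring `s i`. A driver who finds no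
unoccupied spot leaves the set unchanged. -/
def occupied (T : LabeledTree n) (s : Fin n → Fin n) : ℕ → Set (Fin n)
  | 0 => ∅
  | k + 1 => T.occupied s k ∪ {w | ∃ h : k < n, T.ParksAt (T.occupied s k) (s ⟨k, h⟩) w}

/-- `s` is a parking function on `T`: every driver succeeds in parking. -/
def IsParkingFunction (T : LabeledTree n) (s : Fin n → Fin n) : Prop :=
  ∀ i : Fin n, ∃ w, T.ParksAt (T.occupied s i) (s i) w

/-- A parking function `s` on `T` is prime if `|T_v| < |{i : s i ∈ T_v}|` for every vertex `v`
other than the root. -/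
def IsPrime (T : LabeledTree n) (s : Fin n → Fin n) : Prop :=
  T.IsParkingFunction s ∧
    ∀ v, v ≠ T.root → (T.subtree v).ncard < {i | s i ∈ T.subtree v}.ncard

/-- Driver `i` crosses the edge `(u, w)` during her search for a spot: `u` lies on the path from
her preferred spot to the root, and she finds all the vertices on her way up to and including `u`
occupied. -/
def Crosses (T : LabeledTree n) (s : Fin n → Fin n) (i u w : Fin n) : Prop :=
  T.Edge u w ∧ T.Below (s i) u ∧
    ∀ x, T.Below (s i) x → T.Below x u → x ∈ T.occupied s i

/-- During the parking procedure some driver crosses the edge `e = (u, w)` before the edge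
`e' = (u', w')` has been crossed by any driver. -/
def CrossedBefore (T : LabeledTree n) (s : Fin n → Fin n) (e e' : Fin n × Fin n) : Prop :=
  ∃ i, T.Crosses s i e.1 e.2 ∧ ∀ j ≤ i, ¬ T.Crosses s j e'.1 e'.2

end LabeledTree

/-- An ordered (plane) tree with vertex set `Fin n`: a rooted tree in which the children of each
vertex are linearly ordered from left to right. `left u v` says that `u` and `v` are siblings and
`u` is to the left of `v`. -/
structure OrderedTree (n : ℕ) extends LabeledTree n where
  left : Fin n → Fin n → Prop
  left_siblings : ∀ u v, left u v → toLabeledTree.Siblings u v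
  left_trans : ∀ u v w, left u v → left v w → left u w
  left_total : ∀ u v, toLabeledTree.Siblings u v → left u v ∨ left v u

namespace OrderedTree

variable {n : ℕ}

/-- `u` comes before `v` in the post-order traversal of `T` (all children's subtrees from left to
right, then the vertex itself): either `u` is a proper descendant of `v`, or `u` and `v` lie in the
subtrees of two siblings `a` and `b` (possibly `u = a` or `v = b`) with `a` to the left of `b`. -/
def PostOrderBefore (T : OrderedTree n) (u v : Fin n) : Prop :=
  (u ≠ v ∧ T.Below u v) ∨ ∃ a b, T.left a b ∧ T.Below u a ∧ T.Below v b

/-- The vertices of `T` are labeled in post-order. -/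
def IsPostOrderLabeled (T : OrderedTree n) : Prop :=
  ∀ u v, u < v ↔ T.PostOrderBefore u v

/-- `(T, p)` is a standardized restricted prime parking function. -/
structure IsSRP (T : OrderedTree n) (p : Fin n → Fin n) : Prop where
  prime : T.toLabeledTree.IsPrime p
  sibling_order : ∀ u v w, u ≠ v → T.Edge u w → T.Edge v w →
    (T.left u v ↔ T.CrossedBefore p (v, w) (u, w))
  post_order : T.IsPostOrderLabeled

end OrderedTree

/-- The set of standardized restricted prime parking functions on `n` vertices. -/
def SRP (n : ℕ) : Set (OrderedTree n × (Fin n → Fin n)) := {x | x.1.IsSRP x.2}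

end TreeParking

/-! Let P(n) be the number of pairs (rooted tree on `Fin n`, prime parking function). The count has
two halves.

Standardization: for a prime parking function every edge is crossed, and no driver crosses two
sibling edges, so first crossings order the siblings strictly. The plane structure, and with it the
post-order labeling, is thus determined by the unordered pair, and no nontrivial renaming preserves
that labeling. Hence |SRP(n)| · n! = P(n) (`card_SRP_mul_factorial`).

Recursion: for prime pairs the parking condition follows from the counting inequalities
(`isPrime_iff`), so P(n) counts purely combinatorial data. Fix a driver d₀ and remove her. Some
non-root vertex on the path from her preference then has as many drivers as vertices in its subtree;
let u be the lowest one. Cutting the edge u → w gives a prime pair on the subtree at u, and another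
on the rest once d₀ is made to prefer w. Conversely, two prime pairs glue back: the preference of d₀
in the second says where to attach the first, and her new preference is any vertex of the first
(`card_cutFiber`). With a the size of the subtree, P(n) = ∑ C(n,a) C(n-1,a) P(a) a P(n-a), and
P(m+1) = (m+1)! m! · `catalan m` turns this into the Catalan recurrence. -/

namespace TreeParking

/-! ### Rooted trees as parent functions -/

section ParentFunctions

variable {V D : Type*}

/-- `u` reaches `v` by iterating the parent function `f`. -/
def Reaches (f : V → Option V) (u v : V) : Prop :=
  Relation.ReflTransGen (fun a b => f a = some b) u v

/-- `r` is a root of the parent function `f`: it has no parent and every vertex reaches it. -/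
def IsRoot (f : V → Option V) (r : V) : Prop := f r = none ∧ ∀ v, Reaches f v r

/-- A rooted tree with preferences `p` satisfying the strict counting condition at every vertex
other than the root. -/
structure PrimePair (f : V → Option V) (p : D → V) : Prop where
  root : ∃ r, IsRoot f r
  excess : ∀ v w, f v = some w → {x | Reaches f x v}.ncard < {d | Reaches f (p d) v}.ncard

/-- The set of all prime pairs with vertex set `V` and set of drivers `D`. -/
def primePairs (V D : Type*) : Set ((V → Option V) × (D → V)) := {x | PrimePair x.1 x.2}

variable {f : V → Option V}

lemma Reaches.refl (u : V) : Reaches f u u := Relation.ReflTransGen.refl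

lemma Reaches.trans {u v w : V} (h : Reaches f u v) (h' : Reaches f v w) : Reaches f u w :=
  Relation.ReflTransGen.trans h h'

lemma Reaches.single {u v : V} (h : f u = some v) : Reaches f u v :=
  Relation.ReflTransGen.single h

lemma Reaches.eq_or_step {u v : V} (h : Reaches f u v) :
    u = v ∨ ∃ w, f u = some w ∧ Reaches f w v := by
  rcases Relation.ReflTransGen.cases_head h with h | h
  · exact Or.inl h
  · exact Or.inr h

lemma Reaches.eq_or_last {u v : V} (h : Reaches f u v) :
    u = v ∨ ∃ w, Reaches f u w ∧ f w = some v := by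
  rcases Relation.ReflTransGen.cases_tail h with h | h
  · exact Or.inl h.symm
  · exact Or.inr h

lemma Reaches.total {u v w : V} (h : Reaches f u v) (h' : Reaches f u w) :
    Reaches f v w ∨ Reaches f w v := by
  refine Relation.ReflTransGen.total_of_right_unique ?_ h h'
  intro a b c hb hc
  exact Option.some.inj (hb.symm.trans hc)

lemma Reaches.parent {u v w : V} (h : Reaches f u v) (hne : u ≠ v) (hw : f u = some w) :
    Reaches f w v := by
  rcases h.eq_or_step with h | ⟨x, hx, h⟩
  · exact absurd h hne
  · rwa [Option.some.inj (hw.symm.trans hx)]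

namespace IsRoot

variable {r : V} (hr : IsRoot f r)
include hr

/-- A cycle through a vertex also passes through its parent, so it could be pushed up to the root,
which has no outgoing edge. -/
lemma not_cycle (v : V) : ¬ Relation.TransGen (fun a b => f a = some b) v v := by
  induction hr.2 v using Relation.ReflTransGen.head_induction_on with
  | refl =>
    intro h
    rcases Relation.TransGen.head'_iff.1 h with ⟨b, hb, -⟩
    rw [hr.1] at hb
    cases hb
  | head hab _ ih =>
    intro h
    rcases Relation.TransGen.head'_iff.1 h with ⟨b, hb, hb'⟩
    rw [Option.some.inj (hb.symm.trans hab)] at hb'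
    exact ih (Relation.TransGen.tail' hb' hab)

lemma antisymm {u v : V} (h : Reaches f u v) (h' : Reaches f v u) : u = v := by
  by_contra hne
  rcases h.eq_or_step with e | ⟨w, hw, hwv⟩
  · exact hne e
  · exact hr.not_cycle u (Relation.TransGen.head' hw (hwv.trans h'))

lemma parent_ne_none {v : V} (hv : v ≠ r) : ∃ w, f v = some w := by
  rcases (hr.2 v).eq_or_step with e | ⟨w, hw, -⟩
  · exact absurd e hv
  · exact ⟨w, hw⟩

lemma eq_of_reaches {v : V} (h : Reaches f r v) : v = r := by
  rcases h.eq_or_step with e | ⟨w, hw, -⟩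
  · exact e.symm
  · rw [hr.1] at hw; cases hw

lemma siblings_eq {u v w x : V} (hu : f u = some w) (hv : f v = some w)
    (hxu : Reaches f x u) (hxv : Reaches f x v) : u = v := by
  have key : ∀ {a b : V}, f a = some w → f b = some w → Reaches f a b → a = b := by
    intro a b ha hb hab
    by_contra hne
    have := hab.parent hne ha
    exact hr.not_cycle b (Relation.TransGen.head' hb this)
  rcases hxu.total hxv with h | h
  · exact key hu hv h
  · exact (key hv hu h).symm

/-- Two incomparable vertices lie below two distinct siblings. -/
lemma exists_siblings {u v : V} (huv : ¬ Reaches f u v) (hvu : ¬ Reaches f v u) :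
    ∃ a b w, a ≠ b ∧ f a = some w ∧ f b = some w ∧ Reaches f u a ∧ Reaches f v b := by
  -- Climbing from `u`, `a` is the last vertex that is not an ancestor of `v`, and its parent `w` is
  -- the meeting point.
  have key : ∀ y, Reaches f u y → Reaches f v y →
      ∃ a w, Reaches f u a ∧ ¬ Reaches f v a ∧ f a = some w ∧ Reaches f v w := by
    intro y hy
    induction hy with
    | refl => intro h; exact absurd h hvu
    | @tail b c h1 h2 ih =>
      intro h
      by_cases hb : Reaches f v b
      · exact ih hb
      · exact ⟨_, _, h1, hb, h2, h⟩
  obtain ⟨a, w, hua, hva, haw, hvw⟩ := key r (hr.2 u) (hr.2 v)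
  rcases hvw.eq_or_last with e | ⟨b, hvb, hbw⟩
  · subst e
    exact absurd (hua.trans (Reaches.single haw)) huv
  · refine ⟨a, b, w, ?_, haw, hbw, hua, hvb⟩
    rintro rfl
    exact hva hvb

end IsRoot

lemma IsRoot.unique {r r' : V} (hr : IsRoot f r) (hr' : IsRoot f r') : r = r' :=
  hr'.eq_of_reaches (hr'.2 r |>.eq_or_step.elim (fun e => e ▸ Reaches.refl _)
    (fun ⟨w, hw, _⟩ => by rw [hr.1] at hw; cases hw))

end ParentFunctions

/-! ### Invariance of prime pairs under renaming vertices and drivers -/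

section Transport

variable {V D V' D' : Type*}

/-- The parent function transported along an equivalence. -/
def relabelParent (e : V ≃ V') (f : V → Option V) : V' → Option V' :=
  fun x => (f (e.symm x)).map e

lemma relabelParent_eq_some (e : V ≃ V') (f : V → Option V) (x y : V) :
    relabelParent e f (e x) = some (e y) ↔ f x = some y := by
  simp [relabelParent]

lemma reaches_relabel (e : V ≃ V') (f : V → Option V) (x y : V) :
    Reaches (relabelParent e f) (e x) (e y) ↔ Reaches f x y := by
  constructor
  · intro h
    have key : ∀ a b, Reaches (relabelParent e f) a b → Reaches f (e.symm a) (e.symm b) := by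
      intro a b h
      refine Relation.ReflTransGen.lift e.symm ?_ _ _ h
      intro a b hab
      have := relabelParent_eq_some e f (e.symm a) (e.symm b)
      simpa using this.1 (by simpa using hab)
    simpa using key _ _ h
  · intro h
    exact Relation.ReflTransGen.lift e (fun a b hab => (relabelParent_eq_some e f a b).2 hab) _ _ h

lemma IsRoot.relabel (e : V ≃ V') {f : V → Option V} {r : V} (h : IsRoot f r) :
    IsRoot (relabelParent e f) (e r) := by
  refine ⟨by simp [relabelParent, h.1], fun v => ?_⟩
  have := (reaches_relabel e f (e.symm v) r).2 (h.2 _)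
  simpa using this

lemma PrimePair.relabel (e : V ≃ V') (g : D' ≃ D) {f : V → Option V} {p : D → V}
    (h : PrimePair f p) : PrimePair (relabelParent e f) (e ∘ p ∘ g) := by
  obtain ⟨r, hr⟩ := h.root
  refine ⟨⟨e r, hr.relabel e⟩, fun v w hvw => ?_⟩
  obtain ⟨v, rfl⟩ := e.surjective v
  obtain ⟨w, rfl⟩ := e.surjective w
  rw [relabelParent_eq_some] at hvw
  have h1 : {x | Reaches (relabelParent e f) x (e v)} = e '' {x | Reaches f x v} := by
    ext x
    obtain ⟨x, rfl⟩ := e.surjective x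
    simp [reaches_relabel]
  have h2 : {d | Reaches f (p d) v} =
      g '' {d | Reaches (relabelParent e f) ((e ∘ p ∘ g) d) (e v)} := by
    ext d
    obtain ⟨d, rfl⟩ := g.surjective d
    simp [reaches_relabel]
  have := h.excess v w hvw
  rwa [h1, Set.ncard_image_of_injective _ e.injective,
    ← Set.ncard_image_of_injective _ g.injective, ← h2]

lemma relabelParent_symm_apply (e : V ≃ V') (f : V → Option V) :
    relabelParent e.symm (relabelParent e f) = f := by
  funext x
  simp [relabelParent, Option.map_map]

lemma relabelParent_apply_symm (e : V ≃ V') (f : V' → Option V') :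
    relabelParent e (relabelParent e.symm f) = f := by
  funext x
  simp [relabelParent, Option.map_map]

/-- The number of prime pairs depends only on the numbers of vertices and drivers. -/
lemma card_primePairs_congr (e : V ≃ V') (g : D ≃ D') :
    Nat.card (primePairs V D) = Nat.card (primePairs V' D') := by
  refine Nat.card_congr ⟨fun x => ⟨(relabelParent e x.1.1, e ∘ x.1.2 ∘ g.symm),
    PrimePair.relabel e g.symm x.2⟩, fun x => ⟨(relabelParent e.symm x.1.1, e.symm ∘ x.1.2 ∘ g),
    PrimePair.relabel e.symm g x.2⟩, ?_, ?_⟩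
  · rintro ⟨⟨f, p⟩, h⟩
    ext1
    ext1
    · exact relabelParent_symm_apply e f
    · funext d; simp
  · rintro ⟨⟨f, p⟩, h⟩
    ext1
    ext1
    · exact relabelParent_apply_symm e f
    · funext d; simp

end Transport


/-! ### Existence and uniqueness of the cut -/

section Cut

variable {V D : Type*}

/-- `u` is the lowest vertex on the path from `p d₀` to the root for which the number of drivers
other than `d₀` preferring a vertex of the subtree at `u` equals the size of that subtree. The
subtree has vertex set `U`, and `S` is the set of these drivers. -/
structure IsCut (d₀ : D) (f : V → Option V) (p : D → V) (U : Set V) (S : Set D) (u : V) :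
    Prop where
  nonroot : ∃ w, f u = some w
  pref : Reaches f (p d₀) u
  verts : U = {x | Reaches f x u}
  drivers : S = {d | d ≠ d₀ ∧ Reaches f (p d) u}
  card_eq : S.ncard = U.ncard
  lowest : ∀ x, Reaches f (p d₀) x → Reaches f x u → x ≠ u →
    {y | Reaches f y x}.ncard < {d | d ≠ d₀ ∧ Reaches f (p d) x}.ncard

/-- Both cut vertices lie on the path from `p d₀`, hence are comparable; equality at the lower one
would contradict the strict inequality `lowest` of the upper one. -/
lemma IsCut.unique {d₀ : D} {f : V → Option V} {p : D → V} {U U' : Set V} {S S' : Set D}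
    {u u' : V} (h : IsCut d₀ f p U S u) (h' : IsCut d₀ f p U' S' u') : U = U' ∧ S = S' := by
  have key : ∀ {U U' : Set V} {S S' : Set D} {u u' : V}, IsCut d₀ f p U S u →
      IsCut d₀ f p U' S' u' → Reaches f u u' → u = u' := by
    intro U U' S S' u u' h h' hr
    by_contra hne
    have h1 := h'.lowest u h.pref hr hne
    have h2 := h.card_eq
    rw [h.verts, h.drivers] at h2
    omega
  have huu : u = u' := by
    rcases h.pref.total h'.pref with hr | hr
    · exact key h h' hr
    · exact (key h' h hr).symm
  subst huu
  exact ⟨h.verts.trans h'.verts.symm, h.drivers.trans h'.drivers.symm⟩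

/-- Otherwise every non-root vertex keeps its strict excess without `d₀`. Summing over the children
of the root, whose subtrees contain |V| - 1 vertices, would require more than the |D| - 1 remaining
drivers. The bound 2 ≤ |V| ensures that the root has a child. -/
lemma PrimePair.exists_deficient [Finite V] [Finite D] (d₀ : D) {f : V → Option V} {p : D → V}
    (h : PrimePair f p) (hcard : Nat.card D = Nat.card V) (hV : 2 ≤ Nat.card V) :
    ∃ x w, f x = some w ∧ Reaches f (p d₀) x ∧
      {d | d ≠ d₀ ∧ Reaches f (p d) x}.ncard ≤ {y | Reaches f y x}.ncard := by
  classical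
  have := Fintype.ofFinite V
  have := Fintype.ofFinite D
  obtain ⟨r, hr⟩ := h.root
  by_contra! hcon
  have hex : ∀ x w, f x = some w →
      {y | Reaches f y x}.ncard < {d | d ≠ d₀ ∧ Reaches f (p d) x}.ncard := by
    intro x w hx
    by_cases hp : Reaches f (p d₀) x
    · exact hcon x w hx hp
    · have := h.excess x w hx
      have e : {d | d ≠ d₀ ∧ Reaches f (p d) x} = {d | Reaches f (p d) x} := by
        ext d
        simp only [Set.mem_ofPred_eq, and_iff_right_iff_imp]
        rintro hd rfl
        exact hp hd
      rwa [e]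
  let C : Finset V := Finset.univ.filter fun c => f c = some r
  let A : V → Finset V := fun c => Finset.univ.filter fun x => Reaches f x c
  let B : V → Finset D := fun c => Finset.univ.filter fun d => d ≠ d₀ ∧ Reaches f (p d) c
  have hlt : ∀ c ∈ C, (A c).card < (B c).card := by
    intro c hc
    have := hex c r (by simpa [C] using hc)
    simpa [A, B, Set.ncard_eq_toFinset_card'] using this
  have htop : ∀ x, x ≠ r → ∃ c ∈ C, x ∈ A c := by
    intro x hx
    rcases (hr.2 x).eq_or_last with e | ⟨c, hxc, hc⟩
    · exact absurd e hx
    · exact ⟨c, by simpa [C] using hc, by simpa [A] using hxc⟩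
  have hAcard : Fintype.card V - 1 ≤ ∑ c ∈ C, (A c).card := by
    refine le_trans ?_ (Finset.card_biUnion_le (s := C) (t := A))
    rw [← Finset.card_univ, ← Finset.card_erase_of_mem (Finset.mem_univ r)]
    refine Finset.card_le_card fun x hx => ?_
    rw [Finset.mem_biUnion]
    exact htop x (Finset.ne_of_mem_erase hx)
  have hBcard : ∑ c ∈ C, (B c).card ≤ Fintype.card D - 1 := by
    rw [← Finset.card_biUnion, ← Finset.card_univ,
      ← Finset.card_erase_of_mem (Finset.mem_univ d₀)]
    · refine Finset.card_le_card fun d hd => ?_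
      rw [Finset.mem_biUnion] at hd
      obtain ⟨c, -, hd⟩ := hd
      simp only [B, Finset.mem_filter] at hd
      exact Finset.mem_erase.2 ⟨hd.2.1, Finset.mem_univ _⟩
    · intro c hc c' hc' hne
      change Disjoint (B c) (B c')
      rw [Finset.disjoint_left]
      intro d hd hd'
      simp only [B, C, Finset.mem_filter, Finset.coe_filter, Set.mem_ofPred_eq] at hd hd' hc hc'
      exact hne (hr.siblings_eq hc.2 hc'.2 hd.2.2 hd'.2.2)
  have hne : C.Nonempty := by
    rw [Nat.card_eq_fintype_card] at hV
    obtain ⟨x, hx⟩ := Fintype.exists_ne_of_one_lt_card hV r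
    obtain ⟨c, hc, -⟩ := htop x hx
    exact ⟨c, hc⟩
  have := Finset.sum_lt_sum_of_nonempty hne hlt
  rw [Nat.card_eq_fintype_card, Nat.card_eq_fintype_card] at hcard
  omega

/-- Take the deficient vertex with the smallest subtree. Removing one driver lowers a strict excess
to equality at worst, so deficiency means equality there. -/
lemma PrimePair.exists_cut [Finite V] [Finite D] (d₀ : D) {f : V → Option V} {p : D → V}
    (h : PrimePair f p) (hcard : Nat.card D = Nat.card V) (hV : 2 ≤ Nat.card V) :
    ∃ U S u, IsCut d₀ f p U S u := by
  obtain ⟨r, hr⟩ := h.root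
  let X : Set V := {x | (∃ w, f x = some w) ∧ Reaches f (p d₀) x ∧
      {d | d ≠ d₀ ∧ Reaches f (p d) x}.ncard ≤ {y | Reaches f y x}.ncard}
  have hX : X.Nonempty := by
    obtain ⟨x, w, h1, h2, h3⟩ := h.exists_deficient d₀ hcard hV
    exact ⟨x, ⟨w, h1⟩, h2, h3⟩
  obtain ⟨u, ⟨⟨w, hw⟩, hpu, hle⟩, hmin⟩ :=
    Set.exists_min_image X (fun x => {y | Reaches f y x}.ncard) (Set.toFinite X) hX
  refine ⟨_, _, u, ⟨⟨w, hw⟩, hpu, rfl, rfl, ?_, ?_⟩⟩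
  · refine le_antisymm hle ?_
    have h1 := h.excess u w hw
    have h2 : {d | Reaches f (p d) u} ⊆ insert d₀ {d | d ≠ d₀ ∧ Reaches f (p d) u} := by
      intro d hd
      by_cases hdd : d = d₀
      · exact Or.inl hdd
      · exact Or.inr ⟨hdd, hd⟩
    have h3 := Set.ncard_le_ncard h2 (Set.toFinite _)
    have h4 := Set.ncard_insert_le d₀ {d | d ≠ d₀ ∧ Reaches f (p d) u}
    omega
  · intro x hpx hxu hne
    by_contra! hcon
    have hx : ∃ w, f x = some w := by
      rcases hxu.eq_or_step with e | ⟨y, hy, -⟩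
      · exact absurd e hne
      · exact ⟨y, hy⟩
    have h1 := hmin x ⟨hx, hpx, hcon⟩
    have h2 : {y | Reaches f y x} ⊂ {y | Reaches f y u} := by
      refine ⟨fun y hy => hy.trans hxu, fun hsub => hne ?_⟩
      exact hr.antisymm hxu (hsub (Reaches.refl u))
    have h3 := Set.ncard_lt_ncard h2 (Set.toFinite _)
    omega

end Cut

/-! ### Gluing two trees along an edge -/

section Glue

variable {V D : Type*} {U : Set V} {S : Set D}

open Classical in
/-- Attach the root of a tree on `U` to the vertex `w` of a tree on the complement of `U`. -/
noncomputable def glueParent (f₁ : U → Option U) (f₂ : ↥Uᶜ → Option ↥Uᶜ) (w : ↥Uᶜ) :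
    V → Option V :=
  fun x => if h : x ∈ U then some ((f₁ ⟨x, h⟩).elim (w : V) Subtype.val)
    else (f₂ ⟨x, h⟩).map Subtype.val

open Classical in
/-- Join the preferences of the drivers in `S` and outside `S`, redirecting `d₀` to `v`. -/
noncomputable def gluePref (d₀ : D) (p₁ : S → U) (v : U) (p₂ : ↥Sᶜ → ↥Uᶜ) : D → V :=
  fun d => if h : d ∈ S then p₁ ⟨d, h⟩ else if d = d₀ then v else p₂ ⟨d, h⟩

section

variable {f₁ : U → Option U} {f₂ : ↥Uᶜ → Option ↥Uᶜ} {w : ↥Uᶜ}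

lemma glueParent_inside (x : U) :
    glueParent f₁ f₂ w x = some ((f₁ x).elim (w : V) Subtype.val) := by
  simp [glueParent]

lemma glueParent_outside (x : ↥Uᶜ) :
    glueParent f₁ f₂ w x = (f₂ x).map Subtype.val := by
  have hx : (x : V) ∉ U := x.2
  simp [glueParent, hx]

lemma reaches_glue_inside (x y : U) :
    Reaches (glueParent f₁ f₂ w) x y ↔ Reaches f₁ x y := by
  constructor
  · intro h
    -- No edge enters `U` from outside, so a path ending in `U` stays in `U` throughout; the
    -- induction proves membership and reachability together.
    suffices H : ∀ a b : V, Reaches (glueParent f₁ f₂ w) a b → ∀ (hb : b ∈ U),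
        (∃ ha : a ∈ U, Reaches f₁ ⟨a, ha⟩ ⟨b, hb⟩) by
      exact (H x y h y.2).2
    intro a b h hb
    induction h using Relation.ReflTransGen.head_induction_on with
    | refl => exact ⟨hb, Reaches.refl _⟩
    | @head a c hac _ ih =>
      obtain ⟨hc, ih⟩ := ih
      by_cases ha : a ∈ U
      · refine ⟨ha, Reaches.trans (Reaches.single ?_) ih⟩
        have := glueParent_inside (f₁ := f₁) (f₂ := f₂) (w := w) ⟨a, ha⟩
        rw [hac] at this
        cases hfa : f₁ ⟨a, ha⟩ with
        | none =>
          rw [hfa] at this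
          simp only [Option.elim_none, Option.some.injEq] at this
          exact absurd hc (this ▸ w.2)
        | some y =>
          rw [hfa] at this
          simp only [Option.elim_some, Option.some.injEq] at this
          subst this
          rfl
      · have := glueParent_outside (f₁ := f₁) (f₂ := f₂) (w := w) ⟨a, ha⟩
        rw [hac] at this
        obtain ⟨y, -, hy⟩ := Option.map_eq_some_iff.1 this.symm
        exact absurd hc (hy ▸ y.2)
  · intro h
    refine Relation.ReflTransGen.lift Subtype.val (fun a b hab => ?_) _ _ h
    change glueParent f₁ f₂ w a = some (b : V)
    rw [glueParent_inside, hab]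
    rfl

lemma reaches_glue_outside (x y : ↥Uᶜ) :
    Reaches (glueParent f₁ f₂ w) x y ↔ Reaches f₂ x y := by
  constructor
  · intro h
    suffices H : ∀ a b : V, Reaches (glueParent f₁ f₂ w) a b → ∀ (ha : a ∈ Uᶜ),
        (∃ hb : b ∈ Uᶜ, Reaches f₂ ⟨a, ha⟩ ⟨b, hb⟩) by
      exact (H x y h x.2).2
    intro a b h ha
    induction h with
    | refl => exact ⟨ha, Reaches.refl _⟩
    | @tail b c _ hbc ih =>
      obtain ⟨hb, ih⟩ := ih
      have := glueParent_outside (f₁ := f₁) (f₂ := f₂) (w := w) ⟨b, hb⟩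
      rw [hbc] at this
      obtain ⟨y, hy, rfl⟩ := Option.map_eq_some_iff.1 this.symm
      exact ⟨y.2, ih.trans (Reaches.single hy)⟩
  · intro h
    refine Relation.ReflTransGen.lift Subtype.val (fun a b hab => ?_) _ _ h
    change glueParent f₁ f₂ w a = some (b : V)
    rw [glueParent_outside, hab]
    rfl

lemma not_reaches_glue_inside (x : ↥Uᶜ) (y : U) : ¬ Reaches (glueParent f₁ f₂ w) x y := by
  intro h
  suffices H : ∀ a b : V, Reaches (glueParent f₁ f₂ w) a b → a ∈ Uᶜ → b ∈ Uᶜ from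
    H x y h x.2 y.2
  intro a b h ha
  induction h with
  | refl => exact ha
  | @tail b c _ hbc ih =>
    have := glueParent_outside (f₁ := f₁) (f₂ := f₂) (w := w) ⟨b, ih⟩
    rw [hbc] at this
    obtain ⟨y, hy, rfl⟩ := Option.map_eq_some_iff.1 this.symm
    exact y.2

variable {u : U}

lemma glueParent_root (hu : IsRoot f₁ u) : glueParent f₁ f₂ w u = some (w : V) := by
  rw [glueParent_inside, hu.1]
  rfl

/-- The only exit from `U` is the edge from its root `u` to `w`. -/
lemma reaches_glue_inside_outside (hu : IsRoot f₁ u) (x : U) (y : ↥Uᶜ) :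
    Reaches (glueParent f₁ f₂ w) x y ↔ Reaches f₂ w y := by
  rw [← reaches_glue_outside (f₁ := f₁) (w := w)]
  have hxu : Reaches (glueParent f₁ f₂ w) x u := (reaches_glue_inside x u).2 (hu.2 x)
  constructor
  · intro h
    rcases hxu.total h with h | h
    · refine h.parent ?_ (glueParent_root hu)
      intro e
      exact y.2 (e ▸ u.2)
    · exact absurd h (not_reaches_glue_inside y u)
  · intro h
    exact hxu.trans ((Reaches.single (glueParent_root hu)).trans h)

lemma IsRoot.glue {r : ↥Uᶜ} (hu : IsRoot f₁ u) (hr : IsRoot f₂ r) :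
    IsRoot (glueParent f₁ f₂ w) (r : V) := by
  constructor
  · rw [glueParent_outside, hr.1]
    rfl
  · intro x
    by_cases hx : x ∈ U
    · exact (reaches_glue_inside_outside hu ⟨x, hx⟩ r).2 (hr.2 w)
    · exact (reaches_glue_outside ⟨x, hx⟩ r).2 (hr.2 _)

end

end Glue


/-! ### Cutting and gluing preserve primality -/

section GluePrime

variable {V D : Type*} {U : Set V} {S : Set D}
variable {f₁ : U → Option U} {f₂ : ↥Uᶜ → Option ↥Uᶜ} {w : ↥Uᶜ}
variable {d₀ : D} {p₁ : S → U} {v : U} {p₂ : ↥Sᶜ → ↥Uᶜ}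

lemma gluePref_inside (d : S) : gluePref d₀ p₁ v p₂ d = p₁ d := by
  simp [gluePref]

lemma gluePref_special (hd : d₀ ∉ S) : gluePref d₀ p₁ v p₂ d₀ = v := by
  simp [gluePref, hd]

lemma gluePref_outside (d : ↥Sᶜ) (hd : (d : D) ≠ d₀) : gluePref d₀ p₁ v p₂ d = p₂ d := by
  have : (d : D) ∉ S := d.2
  simp [gluePref, hd, this]

lemma verts_glue_inside (y : U) :
    {x | Reaches (glueParent f₁ f₂ w) x y} = Subtype.val '' {x | Reaches f₁ x y} := by
  ext x
  constructor
  · intro h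
    by_cases hx : x ∈ U
    · exact ⟨⟨x, hx⟩, (reaches_glue_inside ⟨x, hx⟩ y).1 h, rfl⟩
    · exact absurd h (not_reaches_glue_inside ⟨x, hx⟩ y)
  · rintro ⟨x, hx, rfl⟩
    exact (reaches_glue_inside x y).2 hx

lemma drivers_glue_inside (hd : d₀ ∉ S) (y : U) :
    {d | d ≠ d₀ ∧ Reaches (glueParent f₁ f₂ w) (gluePref d₀ p₁ v p₂ d) y} =
      Subtype.val '' {d | Reaches f₁ (p₁ d) y} := by
  ext d
  constructor
  · rintro ⟨hne, h⟩
    by_cases hx : d ∈ S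
    · rw [gluePref_inside ⟨d, hx⟩] at h
      exact ⟨⟨d, hx⟩, (reaches_glue_inside _ y).1 h, rfl⟩
    · rw [gluePref_outside ⟨d, hx⟩ hne] at h
      exact absurd h (not_reaches_glue_inside _ y)
  · rintro ⟨d, hx, rfl⟩
    refine ⟨fun e => hd (e ▸ d.2), ?_⟩
    rw [gluePref_inside]
    exact (reaches_glue_inside _ y).2 hx

lemma verts_glue_outside {u : U} (hu : IsRoot f₁ u) (y : ↥Uᶜ) (h : Reaches f₂ w y) :
    {x | Reaches (glueParent f₁ f₂ w) x y} = U ∪ Subtype.val '' {x | Reaches f₂ x y} := by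
  ext x
  by_cases hx : x ∈ U
  · simp only [Set.mem_ofPred_eq, Set.mem_union, hx, true_or, iff_true]
    exact (reaches_glue_inside_outside hu ⟨x, hx⟩ y).2 h
  · have := reaches_glue_outside (f₁ := f₁) (f₂ := f₂) (w := w) ⟨x, hx⟩ y
    simp only at this
    simp [this, hx]

lemma verts_glue_outside_of_not {u : U} (hu : IsRoot f₁ u) (y : ↥Uᶜ) (h : ¬ Reaches f₂ w y) :
    {x | Reaches (glueParent f₁ f₂ w) x y} = Subtype.val '' {x | Reaches f₂ x y} := by
  ext x
  by_cases hx : x ∈ U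
  · have := reaches_glue_inside_outside (f₂ := f₂) (w := w) hu ⟨x, hx⟩ y
    simp only at this
    simp [this, hx, h]
  · have := reaches_glue_outside (f₁ := f₁) (f₂ := f₂) (w := w) ⟨x, hx⟩ y
    simp only at this
    simp [this, hx]

/-- Moving the preference of `d₀` from `w` to `v` is invisible outside `U`, because every path from
`v` leaves `U` through `w`. -/
lemma drivers_glue_outside (hd : d₀ ∉ S) (hw : p₂ ⟨d₀, hd⟩ = w) {u : U} (hu : IsRoot f₁ u)
    (y : ↥Uᶜ) (h : Reaches f₂ w y) :
    {d | Reaches (glueParent f₁ f₂ w) (gluePref d₀ p₁ v p₂ d) y} =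
      S ∪ Subtype.val '' {d | Reaches f₂ (p₂ d) y} := by
  ext d
  by_cases hx : d ∈ S
  · simp only [Set.mem_ofPred_eq, Set.mem_union, hx, true_or, iff_true]
    rw [gluePref_inside ⟨d, hx⟩]
    exact (reaches_glue_inside_outside hu _ y).2 h
  · by_cases hdd : d = d₀
    · subst hdd
      have := reaches_glue_inside_outside (f₂ := f₂) (w := w) hu v y
      simp [gluePref_special hd, this, h, hd, hw]
    · have := reaches_glue_outside (f₁ := f₁) (f₂ := f₂) (w := w) (p₂ ⟨d, hx⟩) y
      have e := gluePref_outside (p₁ := p₁) (v := v) (p₂ := p₂) ⟨d, hx⟩ hdd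
      simp only at e
      simp [e, this, hx]

lemma drivers_glue_outside_of_not (hd : d₀ ∉ S) (hw : p₂ ⟨d₀, hd⟩ = w) {u : U}
    (hu : IsRoot f₁ u) (y : ↥Uᶜ) (h : ¬ Reaches f₂ w y) :
    {d | Reaches (glueParent f₁ f₂ w) (gluePref d₀ p₁ v p₂ d) y} =
      Subtype.val '' {d | Reaches f₂ (p₂ d) y} := by
  ext d
  by_cases hx : d ∈ S
  · have := reaches_glue_inside_outside (f₂ := f₂) (w := w) hu (p₁ ⟨d, hx⟩) y
    have e := gluePref_inside (d₀ := d₀) (p₁ := p₁) (v := v) (p₂ := p₂) ⟨d, hx⟩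
    simp only at e
    simp [e, this, h, hx]
  · by_cases hdd : d = d₀
    · subst hdd
      have := reaches_glue_inside_outside (f₂ := f₂) (w := w) hu v y
      simp [gluePref_special hd, this, h, hd, hw]
    · have := reaches_glue_outside (f₁ := f₁) (f₂ := f₂) (w := w) (p₂ ⟨d, hx⟩) y
      have e := gluePref_outside (p₁ := p₁) (v := v) (p₂ := p₂) ⟨d, hx⟩ hdd
      simp only at e
      simp [e, this, hx]

lemma ncard_union_image_val [Finite V] (A : Set ↥Uᶜ) :
    (U ∪ Subtype.val '' A).ncard = U.ncard + A.ncard := by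
  rw [Set.ncard_union_eq, Set.ncard_image_of_injective _ Subtype.val_injective]
  rw [Set.disjoint_left]
  rintro x hx ⟨y, -, rfl⟩
  exact y.2 hx

/-- Gluing adds |U| = |S| to both sides if `y` is on the path from `w` to the root, and nothing
otherwise. -/
lemma glue_excess_outside [Finite V] [Finite D] (hd : d₀ ∉ S) (hw : p₂ ⟨d₀, hd⟩ = w) {u : U}
    (hu : IsRoot f₁ u) (hcard : S.ncard = U.ncard) (y : ↥Uᶜ) :
    {x | Reaches (glueParent f₁ f₂ w) x y}.ncard <
        {d | Reaches (glueParent f₁ f₂ w) (gluePref d₀ p₁ v p₂ d) y}.ncard ↔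
      {x | Reaches f₂ x y}.ncard < {d | Reaches f₂ (p₂ d) y}.ncard := by
  by_cases h : Reaches f₂ w y
  · rw [verts_glue_outside hu y h, drivers_glue_outside hd hw hu y h, ncard_union_image_val,
      ncard_union_image_val, hcard]
    exact Nat.add_lt_add_iff_left
  · rw [verts_glue_outside_of_not hu y h, drivers_glue_outside_of_not hd hw hu y h,
      Set.ncard_image_of_injective _ Subtype.val_injective,
      Set.ncard_image_of_injective _ Subtype.val_injective]

lemma PrimePair.of_glue [Finite V] [Finite D] (hd : d₀ ∉ S) (hw : p₂ ⟨d₀, hd⟩ = w) {u : U}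
    {r : ↥Uᶜ} (hu : IsRoot f₁ u) (hr : IsRoot f₂ r) (hcard : S.ncard = U.ncard)
    (h : PrimePair (glueParent f₁ f₂ w) (gluePref d₀ p₁ v p₂))
    (hcut : IsCut d₀ (glueParent f₁ f₂ w) (gluePref d₀ p₁ v p₂) U S u) :
    PrimePair f₁ p₁ ∧ PrimePair f₂ p₂ := by
  refine ⟨⟨⟨u, hu⟩, fun y z hyz => ?_⟩, ⟨⟨r, hr⟩, fun y z hyz => ?_⟩⟩
  · have hyu : (y : V) ≠ u := by
      intro e
      rw [Subtype.ext e, hu.1] at hyz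
      cases hyz
    -- On the path of `d₀` the minimality of the cut gives the inequality without her; off that path
    -- she does not contribute to the count.
    have key : {x | Reaches (glueParent f₁ f₂ w) x y}.ncard <
        {d | d ≠ d₀ ∧ Reaches (glueParent f₁ f₂ w) (gluePref d₀ p₁ v p₂ d) y}.ncard := by
      by_cases hvy : Reaches (glueParent f₁ f₂ w) v y
      · refine hcut.lowest y ?_ ((reaches_glue_inside y u).2 (hu.2 y)) hyu
        rwa [gluePref_special hd]
      · have e : {d | d ≠ d₀ ∧ Reaches (glueParent f₁ f₂ w) (gluePref d₀ p₁ v p₂ d) y} =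
            {d | Reaches (glueParent f₁ f₂ w) (gluePref d₀ p₁ v p₂ d) y} := by
          ext d
          simp only [Set.mem_ofPred_eq, and_iff_right_iff_imp]
          rintro hdy rfl
          rw [gluePref_special hd] at hdy
          exact hvy hdy
        rw [e]
        exact h.excess _ _ (glueParent_inside y)
    rwa [verts_glue_inside, drivers_glue_inside hd,
      Set.ncard_image_of_injective _ Subtype.val_injective,
      Set.ncard_image_of_injective _ Subtype.val_injective] at key
  · rw [← glue_excess_outside (v := v) (p₁ := p₁) hd hw hu hcard]
    refine h.excess _ z ?_
    rw [glueParent_outside, hyz]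
    rfl

lemma PrimePair.glue [Finite V] [Finite D] (hd : d₀ ∉ S) (hw : p₂ ⟨d₀, hd⟩ = w) {u : U}
    (hu : IsRoot f₁ u) (hcard : S.ncard = U.ncard)
    (h₁ : PrimePair f₁ p₁) (h₂ : PrimePair f₂ p₂) :
    PrimePair (glueParent f₁ f₂ w) (gluePref d₀ p₁ v p₂) ∧
      IsCut d₀ (glueParent f₁ f₂ w) (gluePref d₀ p₁ v p₂) U S u := by
  have key : ∀ y : U, y ≠ u → {x | Reaches (glueParent f₁ f₂ w) x y}.ncard <
      {d | d ≠ d₀ ∧ Reaches (glueParent f₁ f₂ w) (gluePref d₀ p₁ v p₂ d) y}.ncard := by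
    intro y hy
    rw [verts_glue_inside, drivers_glue_inside hd,
      Set.ncard_image_of_injective _ Subtype.val_injective,
      Set.ncard_image_of_injective _ Subtype.val_injective]
    obtain ⟨z, hz⟩ := hu.parent_ne_none hy
    exact h₁.excess y z hz
  have hU : U = {x | Reaches (glueParent f₁ f₂ w) x u} := by
    rw [verts_glue_inside]
    ext x
    simp [hu.2]
  have hS : S = {d | d ≠ d₀ ∧ Reaches (glueParent f₁ f₂ w) (gluePref d₀ p₁ v p₂ d) u} := by
    rw [drivers_glue_inside hd]
    ext d
    simp [hu.2]
  refine ⟨⟨?_, fun y z hyz => ?_⟩, ⟨⟨_, glueParent_root hu⟩, ?_, hU, hS, hcard, ?_⟩⟩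
  · obtain ⟨r, hr⟩ := h₂.root
    exact ⟨r, hu.glue hr⟩
  · by_cases hy : y ∈ U
    · by_cases hyu : y = u
      · subst hyu
        rw [← hU, ← hcard]
        -- At the cut vertex the drivers in `S` only balance the vertices; strictness comes from
        -- `d₀`.
        refine Set.ncard_lt_ncard ⟨fun d hdS => ?_, fun hsub => hd (hsub ?_)⟩ (Set.toFinite _)
        · rw [hS] at hdS
          exact hdS.2
        · rw [Set.mem_ofPred_eq, gluePref_special hd]
          exact (reaches_glue_inside v u).2 (hu.2 v)
      · refine (key ⟨y, hy⟩ fun e => hyu (congrArg Subtype.val e)).trans_le ?_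
        exact Set.ncard_le_ncard (fun d hdd => hdd.2) (Set.toFinite _)
    · refine (glue_excess_outside hd hw hu hcard ⟨y, hy⟩).2 ?_
      have := glueParent_outside (f₁ := f₁) (f₂ := f₂) (w := w) ⟨y, hy⟩
      rw [hyz] at this
      obtain ⟨z', hz', -⟩ := Option.map_eq_some_iff.1 this.symm
      exact h₂.excess _ z' hz'
  · rw [gluePref_special hd]
    exact (reaches_glue_inside v u).2 (hu.2 v)
  · intro y _ hyu hne
    have hy : y ∈ U := by
      rw [hU]
      exact hyu
    exact key ⟨y, hy⟩ fun e => hne (congrArg Subtype.val e)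

/-- The prime pairs that are cut into `(U, S)` and the complement. -/
def cutFiber (d₀ : D) (U : Set V) (S : Set D) : Set ((V → Option V) × (D → V)) :=
  {x | PrimePair x.1 x.2 ∧ ∃ u, IsCut d₀ x.1 x.2 U S u}

lemma IsCut.exists_glue {f : V → Option V} {p : D → V} {r : V} (hr : IsRoot f r) {u : V}
    (hcut : IsCut d₀ f p U S u) (hd : d₀ ∉ S) :
    ∃ (f₁ : U → Option U) (p₁ : S → U) (v : U) (f₂ : ↥Uᶜ → Option ↥Uᶜ) (p₂ : ↥Sᶜ → ↥Uᶜ)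
      (u' : U) (r' : ↥Uᶜ), IsRoot f₁ u' ∧ IsRoot f₂ r' ∧ (u' : V) = u ∧
      glueParent f₁ f₂ (p₂ ⟨d₀, hd⟩) = f ∧ gluePref d₀ p₁ v p₂ = p := by
  classical
  obtain ⟨w, hw⟩ := hcut.nonroot
  have hU : ∀ x, x ∈ U ↔ Reaches f x u := fun x => by rw [hcut.verts]; rfl
  have hS : ∀ d, d ∈ S ↔ d ≠ d₀ ∧ p d ∈ U := fun d => by rw [hcut.drivers, hU]; rfl
  have huU : u ∈ U := (hU u).2 (Reaches.refl u)
  have hwU : w ∉ U := by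
    intro h
    have := hr.antisymm ((hU w).1 h) (Reaches.single hw)
    subst this
    exact hr.not_cycle w (Relation.TransGen.single hw)
  have hrU : r ∉ U := by
    intro h
    have := hr.eq_of_reaches ((hU r).1 h)
    rw [this, hr.1] at hw
    cases hw
  let restr : (W : Set V) → W → Option W := fun W x =>
    (f x).bind fun y => if h : y ∈ W then some ⟨y, h⟩ else none
  have hrestr : ∀ (W : Set V) (x y : V) (hx : x ∈ W) (hy : y ∈ W), f x = some y →
      restr W ⟨x, hx⟩ = some ⟨y, hy⟩ := by
    intro W x y hx hy h
    simp [restr, h, hy]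
  have hru : restr U ⟨u, huU⟩ = none := by simp [restr, hw, hwU]
  have hrr : restr Uᶜ ⟨r, hrU⟩ = none := by simp [restr, hr.1]
  -- The new preference of `d₀` records the vertex to which the subtree was attached.
  let p₂ : ↥Sᶜ → ↥Uᶜ := fun d => if h : (d : D) = d₀ then ⟨w, hwU⟩
    else ⟨p d, fun hp => d.2 ((hS d).2 ⟨h, hp⟩)⟩
  have hp₂ : p₂ ⟨d₀, hd⟩ = ⟨w, hwU⟩ := by simp [p₂]
  refine ⟨restr U, fun d => ⟨p d, ((hS d).1 d.2).2⟩, ⟨p d₀, (hU _).2 hcut.pref⟩, restr Uᶜ, p₂,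
    ⟨u, huU⟩, ⟨r, hrU⟩, ⟨hru, fun x => ?_⟩, ⟨hrr, fun x => ?_⟩, rfl, ?_, ?_⟩
  · obtain ⟨x, hx⟩ := x
    have hxu := (hU x).1 hx
    induction hxu using Relation.ReflTransGen.head_induction_on with
    | refl => exact Reaches.refl _
    | @head a c hac hcu ih =>
      have hc : c ∈ U := (hU c).2 hcu
      exact (Reaches.single (hrestr U a c hx hc hac)).trans (ih hc)
  · obtain ⟨x, hx⟩ := x
    have hxr := hr.2 x
    induction hxr using Relation.ReflTransGen.head_induction_on with
    | refl => exact Reaches.refl _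
    | @head a c hac hcu ih =>
      have hc : c ∈ Uᶜ := fun hc => hx ((hU a).2 ((Reaches.single hac).trans ((hU c).1 hc)))
      exact (Reaches.single (hrestr Uᶜ a c hx hc hac)).trans (ih hc)
  · rw [hp₂]
    funext x
    by_cases hx : x ∈ U
    · refine (glueParent_inside ⟨x, hx⟩).trans ?_
      rcases ((hU x).1 hx).eq_or_step with rfl | ⟨y, hy, hyu⟩
      · rw [hru, hw]
        rfl
      · rw [hrestr U x y hx ((hU y).2 hyu) hy, hy]
        rfl
    · refine (glueParent_outside ⟨x, hx⟩).trans ?_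
      cases hfx : f x with
      | none => simp [restr, hfx]
      | some y =>
        have hy : y ∈ Uᶜ := fun hy => hx ((hU x).2 ((Reaches.single hfx).trans ((hU y).1 hy)))
        rw [hrestr Uᶜ x y hx hy hfx]
        rfl
  · funext d
    by_cases hdS : d ∈ S
    · exact gluePref_inside ⟨d, hdS⟩
    · by_cases hdd : d = d₀
      · subst hdd
        exact gluePref_special hd
      · refine (gluePref_outside ⟨d, hdS⟩ hdd).trans ?_
        simp [p₂, hdd]

lemma glue_injective (hd : d₀ ∉ S) {f₁ f₁' : U → Option U} {p₁ p₁' : S → U} {v v' : U}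
    {f₂ f₂' : ↥Uᶜ → Option ↥Uᶜ} {p₂ p₂' : ↥Sᶜ → ↥Uᶜ} {u : U} (hu : IsRoot f₁ u)
    (hF : glueParent f₁ f₂ (p₂ ⟨d₀, hd⟩) = glueParent f₁' f₂' (p₂' ⟨d₀, hd⟩))
    (hP : gluePref d₀ p₁ v p₂ = gluePref d₀ p₁' v' p₂') :
    f₁ = f₁' ∧ p₁ = p₁' ∧ v = v' ∧ f₂ = f₂' ∧ p₂ = p₂' := by
  have hf₁ : ∀ x, ((f₁ x).elim (p₂ ⟨d₀, hd⟩ : V) Subtype.val) =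
      (f₁' x).elim (p₂' ⟨d₀, hd⟩ : V) Subtype.val := by
    intro x
    have := congrFun hF x
    rw [glueParent_inside, glueParent_inside] at this
    exact Option.some.inj this
  have hf₁' : f₁ = f₁' := by
    funext x
    have := hf₁ x
    cases h : f₁ x with
    | none =>
      cases h' : f₁' x with
      | none => rfl
      | some y =>
        rw [h, h', Option.elim_none, Option.elim_some] at this
        exact absurd y.2 (this ▸ (p₂ ⟨d₀, hd⟩).2)
    | some y =>
      cases h' : f₁' x with
      | none =>
        rw [h, h', Option.elim_none, Option.elim_some] at this
        exact absurd y.2 (this ▸ (p₂' ⟨d₀, hd⟩).2)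
      | some z =>
        rw [h, h'] at this
        exact congrArg some (Subtype.ext this)
  refine ⟨hf₁', ?_, ?_, ?_, ?_⟩
  · funext d
    have := congrFun hP d
    rw [gluePref_inside, gluePref_inside] at this
    exact Subtype.ext this
  · have := congrFun hP d₀
    rw [gluePref_special hd, gluePref_special hd] at this
    exact Subtype.ext this
  · funext x
    have := congrFun hF x
    rw [glueParent_outside, glueParent_outside] at this
    exact Option.map_injective Subtype.val_injective this
  · funext d
    by_cases hdd : (d : D) = d₀
    · have h := hf₁ u
      rw [← hf₁', hu.1] at h
      have hd' : d = ⟨d₀, hd⟩ := Subtype.ext hdd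
      rw [hd']
      exact Subtype.ext h
    · have := congrFun hP d
      rw [gluePref_outside d hdd, gluePref_outside d hdd] at this
      exact Subtype.ext this

/-- The factor `U.ncard` is the free choice of the vertex `v` that `d₀` prefers after gluing; the
attaching vertex is already part of the second pair. -/
lemma card_cutFiber [Finite V] [Finite D] (hd : d₀ ∉ S) (hcard : S.ncard = U.ncard) :
    Nat.card (cutFiber d₀ U S) =
      Nat.card (primePairs U S) * U.ncard * Nat.card (primePairs ↥Uᶜ ↥Sᶜ) := by
  let glueMap : (primePairs U S × U) × primePairs ↥Uᶜ ↥Sᶜ → cutFiber d₀ U S := fun x =>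
    ⟨(glueParent x.1.1.1.1 x.2.1.1 (x.2.1.2 ⟨d₀, hd⟩), gluePref d₀ x.1.1.1.2 x.1.2 x.2.1.2), by
      obtain ⟨u, hu⟩ := x.1.1.2.root
      have := PrimePair.glue (v := x.1.2) hd rfl hu hcard x.1.1.2 x.2.2
      exact ⟨this.1, u, this.2⟩⟩
  have hglueMap : Function.Bijective glueMap := by
    constructor
    · rintro ⟨⟨⟨⟨f₁, p₁⟩, h₁⟩, v⟩, ⟨⟨f₂, p₂⟩, h₂⟩⟩ ⟨⟨⟨⟨f₁', p₁'⟩, h₁'⟩, v'⟩, ⟨⟨f₂', p₂'⟩, h₂'⟩⟩ h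
      have h := congrArg Subtype.val h
      obtain ⟨u, hu⟩ := h₁.root
      obtain ⟨rfl, rfl, rfl, rfl, rfl⟩ :=
        glue_injective hd hu (congrArg Prod.fst h) (congrArg Prod.snd h)
      rfl
    · rintro ⟨⟨f, p⟩, h, u, hcut⟩
      obtain ⟨r, hr⟩ := h.root
      obtain ⟨f₁, p₁, v, f₂, p₂, u', r', hu', hr', rfl, rfl, rfl⟩ := hcut.exists_glue hr hd
      have := PrimePair.of_glue hd rfl hu' hr' hcard h hcut
      exact ⟨⟨⟨⟨(f₁, p₁), this.1⟩, v⟩, ⟨(f₂, p₂), this.2⟩⟩, rfl⟩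
  rw [← Nat.card_congr (Equiv.ofBijective glueMap hglueMap), Nat.card_prod, Nat.card_prod,
    Nat.card_coe_set_eq U]

end GluePrime


/-! ### The recurrence and its Catalan solution -/

section Counting

lemma card_cutFiber_eq {V D : Type*} [Fintype V] [Fintype D]
    (hVD : Fintype.card D = Fintype.card V) {d₀ : D} (U : Finset V) (S : Finset D) (hd : d₀ ∉ S)
    (hcard : S.card = U.card) :
    Nat.card (cutFiber d₀ (U : Set V) (S : Set D)) =
      Nat.card (primePairs (Fin U.card) (Fin U.card)) * U.card *
        Nat.card (primePairs (Fin (Fintype.card V - U.card)) (Fin (Fintype.card V - U.card))) := by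
  classical
  have hU : Nat.card (U : Set V) = U.card := by simp
  have hS : Nat.card (S : Set D) = U.card := by simp [hcard]
  have hU' : Nat.card ↥(U : Set V)ᶜ = Fintype.card V - U.card := by
    rw [Nat.card_coe_set_eq, Set.ncard_compl, Set.ncard_coe_finset, Nat.card_eq_fintype_card]
  have hS' : Nat.card ↥(S : Set D)ᶜ = Fintype.card V - U.card := by
    rw [Nat.card_coe_set_eq, Set.ncard_compl, Set.ncard_coe_finset, Nat.card_eq_fintype_card,
      hVD, hcard]
  rw [card_cutFiber (by simpa using hd) (by simpa using hcard),
    card_primePairs_congr (Finite.equivFinOfCardEq hU) (Finite.equivFinOfCardEq hS),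
    card_primePairs_congr (Finite.equivFinOfCardEq hU') (Finite.equivFinOfCardEq hS'),
    Set.ncard_coe_finset]

/-- Each pair has exactly one cut, so the fibers over (U, S) partition the pairs. The second
binomial has n - 1 because S avoids `d₀`. -/
lemma card_primePairs_eq_sum (n : ℕ) (hn : 2 ≤ n) :
    Nat.card (primePairs (Fin n) (Fin n)) = ∑ a ∈ Finset.range (n + 1),
      n.choose a * ((n - 1).choose a * (Nat.card (primePairs (Fin a) (Fin a)) * a *
        Nat.card (primePairs (Fin (n - a)) (Fin (n - a))))) := by
  classical
  let d₀ : Fin n := ⟨0, by omega⟩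
  let toPair : (Σ x : Finset (Fin n) × Finset (Fin n), cutFiber d₀ (x.1 : Set (Fin n))
      (x.2 : Set (Fin n))) → primePairs (Fin n) (Fin n) := fun x => ⟨x.2.1, x.2.2.1⟩
  have hbij : Function.Bijective toPair := by
    constructor
    · rintro ⟨⟨U, S⟩, ⟨y, hy, u, hu⟩⟩ ⟨⟨U', S'⟩, ⟨y', hy', u', hu'⟩⟩ h
      obtain rfl : y = y' := congrArg Subtype.val h
      have := hu.unique hu'
      obtain rfl : U = U' := Finset.coe_injective this.1
      obtain rfl : S = S' := Finset.coe_injective this.2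
      rfl
    · rintro ⟨y, hy⟩
      obtain ⟨U, S, u, hu⟩ := hy.exists_cut d₀ rfl (by simpa using hn)
      refine ⟨⟨(U.toFinset, S.toFinset), ⟨y, hy, u, ?_⟩⟩, rfl⟩
      simpa using hu
  have hzero : ∀ U S : Finset (Fin n), S ∉ (Finset.univ.erase d₀).powersetCard U.card →
      Nat.card (cutFiber d₀ (U : Set (Fin n)) (S : Set (Fin n))) = 0 := by
    intro U S hS
    rw [Nat.card_eq_zero]
    left
    rw [isEmpty_subtype]
    rintro y ⟨hy, u, hu⟩
    refine hS (Finset.mem_powersetCard.2 ⟨fun d hd => ?_, ?_⟩)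
    · have hd' : d ∈ (S : Set (Fin n)) := hd
      rw [hu.drivers] at hd'
      exact Finset.mem_erase.2 ⟨hd'.1, Finset.mem_univ _⟩
    · simpa using hu.card_eq
  rw [← Nat.card_congr (Equiv.ofBijective toPair hbij), Nat.card_sigma, Fintype.sum_prod_type]
  have hU : ∀ U : Finset (Fin n), ∑ S : Finset (Fin n),
      Nat.card (cutFiber d₀ (U : Set (Fin n)) (S : Set (Fin n))) =
      (n - 1).choose U.card * (Nat.card (primePairs (Fin U.card) (Fin U.card)) * U.card *
        Nat.card (primePairs (Fin (n - U.card)) (Fin (n - U.card)))) := by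
    intro U
    rw [← Finset.sum_subset (Finset.subset_univ ((Finset.univ.erase d₀).powersetCard U.card))
      fun S _ hS => hzero U S hS]
    rw [Finset.sum_congr rfl fun S hS => ?_, Finset.sum_const, Finset.card_powersetCard,
      Finset.card_erase_of_mem (Finset.mem_univ _), Finset.card_univ, Fintype.card_fin, smul_eq_mul]
    rw [Finset.mem_powersetCard] at hS
    have hd : d₀ ∉ S := fun h => by simpa using hS.1 h
    have h := card_cutFiber_eq rfl U S hd hS.2
    rw [Fintype.card_fin] at h
    exact h
  rw [Finset.sum_congr rfl fun U _ => hU U, ← Finset.powerset_univ,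
    Finset.sum_powerset_apply_card (fun a => (n - 1).choose a *
      (Nat.card (primePairs (Fin a) (Fin a)) * a *
        Nat.card (primePairs (Fin (n - a)) (Fin (n - a)))))]
  simp

lemma card_primePairs_one : Nat.card (primePairs (Fin 1) (Fin 1)) = 1 := by
  have : primePairs (Fin 1) (Fin 1) = {(fun _ => none, id)} := by
    ext ⟨f, p⟩
    constructor
    · intro h
      obtain ⟨r, hr⟩ := h.root
      refine Prod.ext (funext fun x => ?_) (Subsingleton.elim _ _)
      rw [Subsingleton.elim x r]
      exact hr.1
    · rintro h
      obtain ⟨rfl, rfl⟩ := Prod.mk.inj h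
      refine ⟨⟨0, rfl, fun v => ?_⟩, fun v w h => by cases h⟩
      rw [Subsingleton.elim v 0]
      exact Reaches.refl _
  rw [this]
  simp

lemma card_primePairs_fin (m : ℕ) :
    Nat.card (primePairs (Fin (m + 1)) (Fin (m + 1))) = (m + 1)! * (m ! * catalan m) := by
  induction m using Nat.strong_induction_on with
  | _ m ih =>
    rcases m with _ | k
    · rw [card_primePairs_one]
      simp
    -- The end terms a = n and a = 0 vanish, by C(n-1,n) = 0 and the factor a; the others are
    -- indexed by a = i + 1.
    · rw [card_primePairs_eq_sum _ (by omega), Finset.sum_range_succ, Finset.sum_range_succ',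
        catalan_succ', Finset.mul_sum, Finset.mul_sum, Finset.Nat.sum_antidiagonal_eq_sum_range_succ
          (fun i j => (k + 1 + 1)! * ((k + 1)! * (catalan i * catalan j)))]
      simp only [Nat.add_sub_cancel, Nat.choose_succ_self, mul_zero, zero_mul, add_zero]
      refine Finset.sum_congr rfl fun i hi => ?_
      obtain ⟨j, rfl⟩ := Nat.exists_eq_add_of_le (Nat.lt_succ_iff.1 (Finset.mem_range.1 hi))
      have e : i + j + 1 + 1 - (i + 1) = j + 1 := by omega
      have h1 := Nat.add_choose_mul_factorial_mul_factorial (j + 1) (i + 1)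
      have h2 := Nat.add_choose_mul_factorial_mul_factorial j (i + 1)
      rw [show j + 1 + (i + 1) = i + j + 1 + 1 by omega] at h1
      rw [show j + (i + 1) = i + j + 1 by omega] at h2
      rw [e, ih i (by omega), ih j (by omega), ← h1, ← h2, Nat.add_sub_cancel_left]
      simp only [Nat.factorial_succ i]
      ring

end Counting


/-! ### Parking dynamics and the counting condition -/

namespace LabeledTree

variable {n : ℕ} (T : LabeledTree n) {s : Fin n → Fin n}

lemma isRoot : IsRoot T.parent T.root := ⟨T.parent_root, T.reaches_root⟩

lemma occupied_mono {k l : ℕ} (h : k ≤ l) : T.occupied s k ⊆ T.occupied s l := by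
  induction h with
  | refl => exact subset_rfl
  | step _ ih => exact ih.trans Set.subset_union_left

variable {T}

lemma ParksAt.mem_occupied {i : Fin n} {w : Fin n} {k : ℕ}
    (h : T.ParksAt (T.occupied s i) (s i) w) (hk : (i : ℕ) < k) : w ∈ T.occupied s k :=
  T.occupied_mono hk (Or.inr ⟨i.2, h⟩)

lemma exists_parksAt_of_mem_occupied {k : ℕ} {w : Fin n} (h : w ∈ T.occupied s k) :
    ∃ i : Fin n, T.ParksAt (T.occupied s i) (s i) w := by
  induction k with
  | zero => exact absurd h (Set.notMem_empty w)
  | succ k ih =>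
    rcases h with h | ⟨hk, h⟩
    · exact ih h
    · exact ⟨⟨k, hk⟩, h⟩

lemma ParksAt.unique {O : Set (Fin n)} {v w w' : Fin n} (h : T.ParksAt O v w)
    (h' : T.ParksAt O v w') : w = w' := by
  by_contra hne
  rcases Reaches.total (f := T.parent) h.1 h'.1 with hr | hr
  · exact h.2.1 (h'.2.2 w h.1 hr hne)
  · exact h'.2.1 (h.2.2 w' h'.1 hr (Ne.symm hne))

lemma ParksAt.driver_unique {i j w : Fin n} (h : T.ParksAt (T.occupied s i) (s i) w)
    (h' : T.ParksAt (T.occupied s j) (s j) w) : i = j := by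
  rcases lt_trichotomy i j with hij | hij | hij
  · exact absurd (h.mem_occupied hij) h'.2.1
  · exact hij
  · exact absurd (h'.mem_occupied hij) h.2.1

variable (T) in
/-- A driver who meets an unoccupied vertex parks. -/
lemma exists_parksAt {O : Set (Fin n)} {v x : Fin n} (hx : T.Below v x) (hxO : x ∉ O) :
    ∃ w, T.ParksAt O v w := by
  induction hx using Relation.ReflTransGen.head_induction_on with
  | refl =>
    refine ⟨x, Relation.ReflTransGen.refl, hxO, fun y h1 h2 hne => ?_⟩
    exact absurd (T.isRoot.antisymm h2 h1) hne
  | @head a c hac _ ih =>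
    by_cases ha : a ∈ O
    · obtain ⟨w, hw⟩ := ih
      refine ⟨w, Relation.ReflTransGen.head hac hw.1, hw.2.1, fun y h1 h2 hne => ?_⟩
      by_cases hay : a = y
      · exact hay ▸ ha
      · exact hw.2.2 y (Reaches.parent (f := T.parent) h1 hay hac) h2 hne
    · refine ⟨a, Relation.ReflTransGen.refl, ha, fun y h1 h2 hne => ?_⟩
      exact absurd (T.isRoot.antisymm h2 h1) hne

/-- If a vertex stays empty, then all drivers preferring a vertex of its subtree park strictly
below it. -/
lemma ncard_drivers_lt_of_unoccupied {w : Fin n}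
    (hw : ∀ i : Fin n, ¬ T.ParksAt (T.occupied s i) (s i) w) :
    {i | s i ∈ T.subtree w}.ncard < (T.subtree w).ncard := by
  have hocc : ∀ k, w ∉ T.occupied s k := fun k hk => by
    obtain ⟨i, hi⟩ := exists_parksAt_of_mem_occupied hk
    exact hw i hi
  have hpark : ∀ i : Fin n, s i ∈ T.subtree w → ∃ x, T.ParksAt (T.occupied s i) (s i) x :=
    fun i hi => T.exists_parksAt hi (hocc i)
  choose! g hg using hpark
  have hbelow : ∀ i : Fin n, s i ∈ T.subtree w → T.Below (g i) w := by
    intro i hi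
    rcases Reaches.total (f := T.parent) (hg i hi).1 hi with h | h
    · exact h
    · by_cases hne : w = g i
      · rw [← hne]
        exact Relation.ReflTransGen.refl
      · exact absurd ((hg i hi).2.2 w hi h hne) (hocc i)
  have hsub : g '' {i | s i ∈ T.subtree w} ⊂ T.subtree w := by
    refine Set.ssubset_iff_subset_ne.2 ⟨?_, fun e => ?_⟩
    · rintro _ ⟨i, hi, rfl⟩
      exact hbelow i hi
    · have : w ∈ T.subtree w := Relation.ReflTransGen.refl
      rw [← e] at this
      obtain ⟨i, hi, hiw⟩ := this
      exact hw i (hiw ▸ hg i hi)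
  rw [← Set.InjOn.ncard_image (f := g)]
  · exact Set.ncard_lt_ncard hsub (Set.toFinite _)
  · intro i hi j hj hij
    exact (hg i hi).driver_unique (hij ▸ hg j hj)

/-- By `ncard_drivers_lt_of_unoccupied` every vertex gets filled. Choosing a driver for each vertex
is injective from `Fin n` to itself, hence surjective, so every driver parks. -/
lemma isParkingFunction_of_le
    (h : ∀ w, (T.subtree w).ncard ≤ {i | s i ∈ T.subtree w}.ncard) : T.IsParkingFunction s := by
  have hall : ∀ w, ∃ i : Fin n, T.ParksAt (T.occupied s i) (s i) w := by
    intro w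
    by_contra! hw
    exact (ncard_drivers_lt_of_unoccupied hw).not_ge (h w)
  choose d hd using hall
  have hinj : Function.Injective d := by
    intro w w' e
    have h' := hd w'
    rw [← e] at h'
    exact (hd w).unique h'
  intro i
  obtain ⟨w, rfl⟩ := Finite.injective_iff_surjective.1 hinj i
  exact ⟨w, hd w⟩

lemma isPrime_iff : T.IsPrime s ↔ PrimePair T.parent s := by
  constructor
  · rintro ⟨-, h⟩
    refine ⟨⟨T.root, T.isRoot⟩, fun v w hvw => h v ?_⟩
    rintro rfl
    rw [T.parent_root] at hvw
    cases hvw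
  · intro h
    have hlt : ∀ v, v ≠ T.root → (T.subtree v).ncard < {i | s i ∈ T.subtree v}.ncard := by
      intro v hv
      obtain ⟨w, hw⟩ := T.isRoot.parent_ne_none hv
      exact h.excess v w hw
    refine ⟨isParkingFunction_of_le fun v => ?_, hlt⟩
    by_cases hv : v = T.root
    · subst hv
      have h1 : T.subtree T.root = Set.univ := Set.eq_univ_of_forall T.reaches_root
      simp [h1]
    · exact (hlt v hv).le

/-- Every edge is crossed by some driver of a prime parking function. -/
lemma IsPrime.exists_crosses (h : T.IsPrime s) {v w : Fin n} (hvw : T.Edge v w) :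
    ∃ i, T.Crosses s i v w := by
  obtain ⟨hpark, hcount⟩ := h
  choose g hg using hpark
  have hv : v ≠ T.root := by
    rintro rfl
    rw [Edge, T.parent_root] at hvw
    cases hvw
  -- Drivers park at distinct spots and more of them prefer the subtree than it can hold, so one
  -- parks outside and must cross the edge above `v`.
  obtain ⟨i, hi, hgi⟩ : ∃ i, s i ∈ T.subtree v ∧ g i ∉ T.subtree v := by
    by_contra! hcon
    refine (hcount v hv).not_ge (Set.ncard_le_ncard_of_injOn g hcon ?_ (Set.toFinite _))
    intro i _ j _ hij
    exact (hg i).driver_unique (hij ▸ hg j)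
  refine ⟨i, hvw, hi, fun x h1 h2 => ?_⟩
  rcases Reaches.total (f := T.parent) h1 (hg i).1 with h | h
  · refine (hg i).2.2 x h1 h ?_
    rintro rfl
    exact hgi h2
  · exact absurd (Relation.ReflTransGen.trans h h2) hgi

/-- `u` and `v` are siblings and the edge above `v` is crossed before the edge above `u`. -/
def CrossedLater (T : LabeledTree n) (s : Fin n → Fin n) (u v : Fin n) : Prop :=
  ∃ w, u ≠ v ∧ T.Edge u w ∧ T.Edge v w ∧ T.CrossedBefore s (v, w) (u, w)

lemma CrossedLater.siblings {u v : Fin n} (h : T.CrossedLater s u v) : T.Siblings u v := by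
  obtain ⟨w, hne, hu, hv, -⟩ := h
  exact ⟨hne, w, hu, hv⟩

lemma CrossedLater.trans {u v x : Fin n} (h : T.CrossedLater s u v)
    (h' : T.CrossedLater s v x) : T.CrossedLater s u x := by
  obtain ⟨w, -, hu, hv, i, hi, hi'⟩ := h
  obtain ⟨w', -, hv', hx, j, hj, hj'⟩ := h'
  obtain rfl : w = w' := Option.some.inj (hv.symm.trans hv')
  have hji : j < i := lt_of_not_ge fun hij => hj' i hij hi
  have hcross : ∀ k ≤ j, ¬ T.Crosses s k u w := fun k hk => hi' k (hk.trans hji.le)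
  refine ⟨w, ?_, hu, hx, j, hj, hcross⟩
  rintro rfl
  exact hcross j le_rfl hj

/-- Consider the first driver crossing either edge. She cannot cross both, since no vertex lies
below two distinct siblings. -/
lemma IsPrime.crossedLater_total (h : T.IsPrime s) {u v : Fin n} (huv : T.Siblings u v) :
    T.CrossedLater s u v ∨ T.CrossedLater s v u := by
  obtain ⟨hne, w, hu, hv⟩ := huv
  have key : ∀ {a b : Fin n}, a ≠ b → T.Edge a w → T.Edge b w → ∀ i, T.Crosses s i a w →
      (∀ k < i, ¬ T.Crosses s k b w) → T.CrossedLater s b a := by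
    intro a b hab ha hb i hi hk
    refine ⟨w, hab.symm, hb, ha, i, hi, fun k hki hkb => ?_⟩
    rcases hki.lt_or_eq with hlt | rfl
    · exact hk k hlt hkb
    · exact hab (T.isRoot.siblings_eq ha hb hi.2.1 hkb.2.1)
  obtain ⟨i, hi, hmin⟩ : ∃ i, (T.Crosses s i u w ∨ T.Crosses s i v w) ∧
      ∀ k < i, ¬ (T.Crosses s k u w ∨ T.Crosses s k v w) := by
    obtain ⟨j, hj⟩ := h.exists_crosses hu
    obtain ⟨i, hi, hmin⟩ := WellFounded.has_min (wellFounded_lt (α := Fin n))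
      {i | T.Crosses s i u w ∨ T.Crosses s i v w} ⟨j, Or.inl hj⟩
    exact ⟨i, hi, fun k hk hk' => hmin k hk' hk⟩
  rcases hi with hi | hi
  · exact Or.inr (key hne hu hv i hi fun k hk h' => hmin k hk (Or.inr h'))
  · exact Or.inl (key hne.symm hv hu i hi fun k hk h' => hmin k hk (Or.inl h'))

end LabeledTree


/-! ### Post-order as a strict total order, and renaming of trees -/

/-- The permutation sends each element to its number of predecessors. Applied to post-order, it
produces the standard labeling. -/
lemma exists_perm_of_strict_order {n : ℕ} (R : Fin n → Fin n → Prop) (hirr : ∀ u, ¬ R u u)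
    (htrans : ∀ u v w, R u v → R v w → R u w) (htri : ∀ u v, u ≠ v → R u v ∨ R v u) :
    ∃ σ : Equiv.Perm (Fin n), ∀ u v, R u v ↔ σ u < σ v := by
  have hlt : ∀ u, {x | R x u}.ncard < n := by
    intro u
    have h : {x | R x u} ⊂ Set.univ := Set.ssubset_univ_iff.2 fun e => hirr u (by
      have : u ∈ {x | R x u} := e ▸ Set.mem_univ u
      exact this)
    simpa using Set.ncard_lt_ncard h (Set.toFinite _)
  let g : Fin n → Fin n := fun u => ⟨{x | R x u}.ncard, hlt u⟩
  have hmono : ∀ u v, R u v → g u < g v := by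
    intro u v huv
    exact Set.ncard_lt_ncard (Set.ssubset_iff_subset_ne.2 ⟨fun x hx => htrans x u v hx huv,
      fun e => hirr u (by
        have : u ∈ {x | R x u} := e ▸ huv
        exact this)⟩) (Set.toFinite _)
  have hinj : Function.Injective g := by
    intro u v e
    by_contra hne
    rcases htri u v hne with h | h
    · exact (hmono u v h).ne e
    · exact (hmono v u h).ne e.symm
  refine ⟨Equiv.ofBijective g (Finite.injective_iff_bijective.1 hinj), fun u v =>
    ⟨hmono u v, fun h => ?_⟩⟩
  change g u < g v at h
  rcases eq_or_ne u v with rfl | hne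
  · exact absurd h (lt_irrefl _)
  · exact (htri u v hne).resolve_right fun h' => (hmono v u h').asymm h

namespace LabeledTree

variable {n : ℕ}

/-- The post-order relation determined by a left-to-right relation on the siblings of a tree. -/
def PostBefore (T : LabeledTree n) (l : Fin n → Fin n → Prop) (u v : Fin n) : Prop :=
  (u ≠ v ∧ T.Below u v) ∨ ∃ a b, l a b ∧ T.Below u a ∧ T.Below v b

section PostOrder

variable {T : LabeledTree n} {l : Fin n → Fin n → Prop}

lemma Siblings.eq_of_below {a b x : Fin n} (h : T.Siblings a b) (ha : T.Below x a)
    (hb : T.Below x b) : False := by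
  obtain ⟨hne, w, haw, hbw⟩ := h
  exact hne (T.isRoot.siblings_eq haw hbw ha hb)

lemma Siblings.below_of_below {a b v : Fin n} (h : T.Siblings a b) (hv : T.Below b v)
    (hne : b ≠ v) : T.Below a v ∧ a ≠ v := by
  have hav : T.Below a v := by
    obtain ⟨-, w, haw, hbw⟩ := h
    exact Relation.ReflTransGen.head haw (Reaches.parent (f := T.parent) hv hne hbw)
  refine ⟨hav, ?_⟩
  rintro rfl
  exact h.eq_of_below hv Relation.ReflTransGen.refl

lemma postBefore_irrefl (hl : ∀ u v, l u v → T.Siblings u v) (u : Fin n) :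
    ¬ T.PostBefore l u u := by
  rintro (⟨h, -⟩ | ⟨a, b, hab, ha, hb⟩)
  · exact h rfl
  · exact (hl a b hab).eq_of_below ha hb

lemma postBefore_total (htot : ∀ u v, T.Siblings u v → l u v ∨ l v u) (u v : Fin n)
    (hne : u ≠ v) : T.PostBefore l u v ∨ T.PostBefore l v u := by
  by_cases huv : T.Below u v
  · exact Or.inl (Or.inl ⟨hne, huv⟩)
  by_cases hvu : T.Below v u
  · exact Or.inr (Or.inl ⟨hne.symm, hvu⟩)
  obtain ⟨a, b, w, hab, ha, hb, hua, hvb⟩ := T.isRoot.exists_siblings huv hvu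
  rcases htot a b ⟨hab, w, ha, hb⟩ with h | h
  · exact Or.inl (Or.inr ⟨a, b, h, hua, hvb⟩)
  · exact Or.inr (Or.inr ⟨b, a, h, hvb, hua⟩)

/-- When both relations come from sibling pairs (a, b) and (c, d), the vertices b and c are
ancestors of v and so comparable. If they differ, the sibling of the lower one also lies below the
upper one, and the upper pair separates u from x. -/
lemma postBefore_trans (hl : ∀ u v, l u v → T.Siblings u v)
    (hltrans : ∀ u v w, l u v → l v w → l u w) (u v x : Fin n)
    (h : T.PostBefore l u v) (h' : T.PostBefore l v x) : T.PostBefore l u x := by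
  have trans : ∀ {a b c : Fin n}, T.Below a b → T.Below b c → T.Below a c :=
    fun h h' => Relation.ReflTransGen.trans h h'
  rcases h with ⟨hne, huv⟩ | ⟨a, b, hab, hua, hvb⟩
  · rcases h' with ⟨hne', hvx⟩ | ⟨c, d, hcd, hvc, hxd⟩
    · refine Or.inl ⟨?_, trans huv hvx⟩
      rintro rfl
      exact hne (T.isRoot.antisymm huv hvx)
    · exact Or.inr ⟨c, d, hcd, trans huv hvc, hxd⟩
  · rcases h' with ⟨-, hvx⟩ | ⟨c, d, hcd, hvc, hxd⟩
    · by_cases hxb : T.Below x b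
      · exact Or.inr ⟨a, b, hab, hua, hxb⟩
      · have hbx : T.Below b x := (Reaches.total (f := T.parent) hvb hvx).resolve_right hxb
        have hbne : b ≠ x := by
          rintro rfl
          exact hxb Relation.ReflTransGen.refl
        obtain ⟨hax, hane⟩ := (hl a b hab).below_of_below hbx hbne
        refine Or.inl ⟨?_, trans hua hax⟩
        rintro rfl
        exact hane (T.isRoot.antisymm hax hua)
    · by_cases hbc : b = c
      · subst hbc
        exact Or.inr ⟨a, d, hltrans a b d hab hcd, hua, hxd⟩
      · rcases Reaches.total (f := T.parent) hvb hvc with h | h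
        · exact Or.inr ⟨c, d, hcd, trans hua ((hl a b hab).below_of_below h hbc).1, hxd⟩
        · have hdc : T.Siblings d c := by
            obtain ⟨hne, w, hcw, hdw⟩ := hl c d hcd
            exact ⟨hne.symm, w, hdw, hcw⟩
          exact Or.inr ⟨a, b, hab, hua,
            trans hxd (hdc.below_of_below h (Ne.symm hbc)).1⟩

end PostOrder

/-- The tree with its vertices renamed by `σ`. -/
def relabel (T : LabeledTree n) (σ : Equiv.Perm (Fin n)) : LabeledTree n where
  parent := relabelParent σ T.parent
  root := σ T.root
  parent_root := (T.isRoot.relabel σ).1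
  reaches_root := (T.isRoot.relabel σ).2

lemma eq_of_parent_eq {T T' : LabeledTree n} (h : T.parent = T'.parent) : T = T' := by
  have hr : T.root = T'.root := by
    have h' := T.isRoot
    rw [h] at h'
    exact h'.unique T'.isRoot
  cases T
  cases T'
  cases h
  cases hr
  rfl

section Relabel

variable (T : LabeledTree n) (σ : Equiv.Perm (Fin n)) (s : Fin n → Fin n)

lemma edge_relabel (u v : Fin n) : (T.relabel σ).Edge (σ u) (σ v) ↔ T.Edge u v :=
  relabelParent_eq_some σ T.parent u v

lemma below_relabel (u v : Fin n) : (T.relabel σ).Below (σ u) (σ v) ↔ T.Below u v :=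
  reaches_relabel σ T.parent u v

lemma parksAt_relabel (O : Set (Fin n)) (v w : Fin n) :
    (T.relabel σ).ParksAt (σ '' O) (σ v) (σ w) ↔ T.ParksAt O v w := by
  refine and_congr (below_relabel T σ v w) (and_congr (not_congr σ.injective.mem_set_image)
    (σ.surjective.forall.trans (forall_congr' fun x => ?_)))
  rw [below_relabel, below_relabel, σ.injective.ne_iff, σ.injective.mem_set_image]

lemma occupied_relabel (k : ℕ) : (T.relabel σ).occupied (σ ∘ s) k = σ '' T.occupied s k := by
  induction k with
  | zero => simp [occupied]
  | succ k ih =>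
    rw [occupied, occupied, ih, Set.image_union]
    congr 1
    ext w
    obtain ⟨w, rfl⟩ := σ.surjective w
    rw [σ.injective.mem_set_image]
    simp only [Set.mem_ofPred_eq, Function.comp_apply, parksAt_relabel]

lemma crosses_relabel (i u v : Fin n) :
    (T.relabel σ).Crosses (σ ∘ s) i (σ u) (σ v) ↔ T.Crosses s i u v := by
  refine and_congr (edge_relabel T σ u v) (and_congr (below_relabel T σ (s i) u)
    (σ.surjective.forall.trans (forall_congr' fun x => ?_)))
  rw [occupied_relabel, Function.comp_apply, below_relabel, below_relabel,
    σ.injective.mem_set_image]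

lemma crossedLater_relabel (u v : Fin n) :
    (T.relabel σ).CrossedLater (σ ∘ s) (σ u) (σ v) ↔ T.CrossedLater s u v := by
  refine σ.surjective.exists.trans (exists_congr fun w => ?_)
  simp only [CrossedBefore, edge_relabel, crosses_relabel, σ.injective.ne_iff]

lemma postBefore_relabel (u v : Fin n) :
    (T.relabel σ).PostBefore ((T.relabel σ).CrossedLater (σ ∘ s)) (σ u) (σ v) ↔
      T.PostBefore (T.CrossedLater s) u v := by
  refine or_congr ?_ (σ.surjective.exists.trans (exists_congr fun a =>
    σ.surjective.exists.trans (exists_congr fun b => ?_)))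
  · rw [below_relabel, σ.injective.ne_iff]
  · rw [below_relabel, below_relabel, crossedLater_relabel]

lemma isPrime_relabel (h : T.IsPrime s) : (T.relabel σ).IsPrime (σ ∘ s) :=
  isPrime_iff.2 ((isPrime_iff.1 h).relabel σ (Equiv.refl _))

end Relabel

end LabeledTree

/-! ### Standardization: one labeling per renaming class -/

namespace OrderedTree

variable {n : ℕ} {T T' : OrderedTree n} {p p' : Fin n → Fin n}

/-- The plane structure is no extra datum: it can be read off from the tree and the preferences. -/
lemma IsSRP.left_eq (h : T.IsSRP p) : T.left = T.toLabeledTree.CrossedLater p := by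
  ext u v
  constructor
  · intro huv
    obtain ⟨hne, w, hu, hv⟩ := T.left_siblings u v huv
    exact ⟨w, hne, hu, hv, (h.sibling_order u v w hne hu hv).1 huv⟩
  · rintro ⟨w, hne, hu, hv, hc⟩
    exact (h.sibling_order u v w hne hu hv).2 hc

lemma IsSRP.lt_iff (h : T.IsSRP p) (u v : Fin n) :
    u < v ↔ T.toLabeledTree.PostBefore (T.toLabeledTree.CrossedLater p) u v := by
  rw [← h.left_eq]
  exact h.post_order u v

lemma eq_of_toLabeledTree_eq (h : T.toLabeledTree = T'.toLabeledTree) (hl : T.left = T'.left) :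
    T = T' := by
  cases T
  cases T'
  cases h
  cases hl
  rfl

/-- Post-order commutes with renaming and is the usual order on both sides, so `σ` is an order
automorphism of `Fin n`, hence trivial. -/
lemma IsSRP.eq_refl_of_relabel (h : T.IsSRP p) (h' : T'.IsSRP p') (σ : Equiv.Perm (Fin n))
    (hT : T'.toLabeledTree = T.toLabeledTree.relabel σ) (hp : p' = σ ∘ p) :
    σ = Equiv.refl _ := by
  have hlt : ∀ u v, σ u < σ v ↔ u < v := by
    intro u v
    rw [h.lt_iff u v, h'.lt_iff (σ u) (σ v), hT, hp, LabeledTree.postBefore_relabel]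
  have : StrictMono σ := fun u v huv => (hlt u v).2 huv
  have hid : (StrictMono.orderIsoOfSurjective σ this σ.surjective) = OrderIso.refl _ :=
    Subsingleton.elim _ _
  ext1 x
  exact congrArg (fun e : Fin n ≃o Fin n => e x) hid

end OrderedTree

/-- Every prime parking function on a labeled tree arises from exactly one standardized restricted
prime parking function by a renaming of the vertices. -/
lemma card_SRP_mul_factorial (n : ℕ) :
    Nat.card (SRP n) * n ! = Nat.card (primePairs (Fin n) (Fin n)) := by
  let rename : SRP n × Equiv.Perm (Fin n) → primePairs (Fin n) (Fin n) := fun x =>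
    ⟨(relabelParent x.2 x.1.1.1.parent, x.2 ∘ x.1.1.2), LabeledTree.isPrime_iff.1
      (LabeledTree.isPrime_relabel x.1.1.1.toLabeledTree x.2 x.1.1.2 x.1.2.prime)⟩
  have hbij : Function.Bijective rename := by
    constructor
    · rintro ⟨⟨⟨T, p⟩, h⟩, σ⟩ ⟨⟨⟨T', p'⟩, h'⟩, τ⟩ e
      have e := congrArg Subtype.val e
      have e₁ : relabelParent σ T.parent = relabelParent τ T'.parent := congrArg Prod.fst e
      have e₂ : σ ∘ p = τ ∘ p' := congrArg Prod.snd e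
      have hp : p' = (σ.trans τ.symm) ∘ p := by
        funext i
        have : σ (p i) = τ (p' i) := congrFun e₂ i
        simp [this]
      have hT : T'.toLabeledTree = T.toLabeledTree.relabel (σ.trans τ.symm) := by
        refine LabeledTree.eq_of_parent_eq ?_
        rw [← relabelParent_symm_apply τ T'.parent, ← e₁]
        funext x
        simp [LabeledTree.relabel, relabelParent, Option.map_map, Function.comp_def]
      have hid : σ.trans τ.symm = Equiv.refl _ :=
        OrderedTree.IsSRP.eq_refl_of_relabel h h' _ hT hp
      have hστ : σ = τ := by
        ext1 x
        have : τ.symm (σ x) = x := congrArg (fun e : Equiv.Perm (Fin n) => e x) hid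
        rw [← τ.apply_symm_apply (σ x), this]
      subst hστ
      obtain rfl : p' = p := by rw [hp, hid]; rfl
      have hTT : T = T' := by
        have hl : T.toLabeledTree = T'.toLabeledTree := by
          refine LabeledTree.eq_of_parent_eq ?_
          rw [← relabelParent_symm_apply σ T.parent, e₁, relabelParent_symm_apply]
        refine OrderedTree.eq_of_toLabeledTree_eq hl ?_
        rw [OrderedTree.IsSRP.left_eq h, OrderedTree.IsSRP.left_eq h', hl]
      subst hTT
      rfl
    · rintro ⟨⟨f, p⟩, h⟩
      obtain ⟨r, hr⟩ := h.root
      let T : LabeledTree n := ⟨f, r, hr.1, hr.2⟩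
      have hT : T.IsPrime p := LabeledTree.isPrime_iff.2 h
      have hl : ∀ u v, T.CrossedLater p u v → T.Siblings u v := fun u v h => h.siblings
      -- `σ` renames the given pair into post-order; `σ.symm` then recovers it from the standardized
      -- one.
      obtain ⟨σ, hσ⟩ := exists_perm_of_strict_order (T.PostBefore (T.CrossedLater p))
        (LabeledTree.postBefore_irrefl hl)
        (LabeledTree.postBefore_trans hl fun u v w h h' => h.trans h')
        (LabeledTree.postBefore_total fun u v h => hT.crossedLater_total h)
      have hT' : (T.relabel σ).IsPrime (σ ∘ p) := T.isPrime_relabel σ p hT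
      let O : OrderedTree n :=
        { T.relabel σ with
          left := (T.relabel σ).CrossedLater (σ ∘ p)
          left_siblings := fun u v h => h.siblings
          left_trans := fun u v w h h' => h.trans h'
          left_total := fun u v h => hT'.crossedLater_total h }
      have hO : O.IsSRP (σ ∘ p) := by
        refine ⟨hT', fun u v w hne hu hv => ⟨?_, fun h => ⟨w, hne, hu, hv, h⟩⟩, fun u v => ?_⟩
        · rintro ⟨w', -, hu', -, h⟩
          obtain rfl : w = w' := Option.some.inj (hu.symm.trans hu')
          exact h
        · obtain ⟨u, rfl⟩ := σ.surjective u
          obtain ⟨v, rfl⟩ := σ.surjective v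
          rw [← hσ]
          exact (T.postBefore_relabel σ p u v).symm
      refine ⟨(⟨(O, σ ∘ p), hO⟩, σ.symm), Subtype.ext (Prod.ext ?_ ?_)⟩
      · exact relabelParent_symm_apply σ f
      · funext i
        simp [rename]
  rw [← Nat.card_congr (Equiv.ofBijective rename hbij), Nat.card_prod, Nat.card_perm,
    Nat.card_fin]

end TreeParking

theorem lemma4p3 (n : ℕ) (hn : 1 ≤ n) :
    (TreeParking.SRP n).ncard = catalan (n - 1) * (n - 1)! := by
  obtain ⟨m, rfl⟩ := Nat.exists_eq_add_of_le' hn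
  have h := TreeParking.card_SRP_mul_factorial (m + 1)
  rw [TreeParking.card_primePairs_fin, mul_comm] at h
  rw [Nat.add_sub_cancel, mul_comm (catalan m), ← Nat.card_coe_set_eq]
  exact Nat.eq_of_mul_eq_mul_left (Nat.factorial_pos _) h
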